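/- Let $\mathbf E$ be a complex Banach space whose elements are complex sequences $x=(x(n))_{n\ge 0}$ (with the usual linear operations), containing the space $F$ of all finitely supported sequences, and assume: (1) $F$ is dense in $\mathbf E$; (2) every coordinate map $x\mapsto x(n)$ is continuous on $\mathbf E$; (3) for every $z\in\mathbb C$ with $|z|=1$ the map $\gamma_z : (x(n))_n\mapsto (z^n x(n))_n$ sends $\mathbf E$ into $\mathbf E$, and $\sup_{|z|=1}\|\gamma_z\|<\infty$. Let $(\mathbf S u)(0)=0$, $(\mathbf S u)(n)=u(n-1)$ for $n\ge 1$, and $(\mathbf S_{-1}u)(n)=u(n+1)$ for $n\ge 0$. Suppose that $\mathbf S(\mathbf E)\subset\mathbf E$ and $\mathbf S_{-1}(\mathbf E)\subset\mathbf E$; then $\mathbf S$ and $\mathbf S_{-1}$ are bounded operators on $\mathbf E$ (closed graph theorem), and $\sigma(\cdot)$ denotes the spectrum of a bounded operator on $\mathbf E$. Let $e_k$ be the sequence equal to $1$ at $k$ and $0$ elsewhere. For a bounded operator $T$ on $\mathbf E$ put $\widehat T(n)=(Te_0)(n)$ and $\widehat T(-n)=(Te_n)(0)$ for $n\ge 0$,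 and let $\widetilde T(z)=\sum_{n\in\mathbb Z}\widehat T(n)z^n$ be its symbol. (a) If $T$ is a bounded operator on $\mathbf E$ commuting with $\mathbf S$, then the series $\widetilde T(z)$ converges absolutely for every $z$ in the interior of $\sigma(\mathbf S)$ (its coefficients of negative index vanish), and $$\overline{\Bigl\{\widetilde T(z) : z\in \overset{\circ}{\sigma(\mathbf S)}\Bigr\}}\subset\sigma(T).$$ (b) If $T$ is a bounded operator on $\mathbf E$ commuting with $\mathbf S_{-1}$, then the series $\widetilde T(1/z)$ converges absolutely for every $z\neq 0$ in the interior of $\sigma(\mathbf S_{-1})$, and $$\overline{\Bigl\{\widetilde T(1/z) : z\in \overset{\circ}{\sigma(\mathbf S_{-1})},\ z\ne 0\Bigr\}}\subset\sigma(T).$$ -/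

import Mathlib

open Set

/-- The forward shift on all complex sequences: `(S u)(0) = 0` and `(S u)(n + 1) = u n`. -/
def seqShift : (ℕ → ℂ) →ₗ[ℂ] (ℕ → ℂ) where
  toFun u n := if n = 0 then 0 else u (n - 1)
  map_add' u v := by
    funext n
    by_cases h : n = 0 <;> simp [h]
  map_smul' c u := by
    funext n
    by_cases h : n = 0 <;> simp [h]

/-- The backward shift on all complex sequences: `(S₋₁ u)(n) = u (n + 1)`. -/
def seqBackShift : (ℕ → ℂ) →ₗ[ℂ] (ℕ → ℂ) where
  toFun u n := u (n + 1)
  map_add' _ _ := rfl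
  map_smul' _ _ := rfl

theorem continuous_seqShift : Continuous seqShift := by
  refine continuous_pi fun n => ?_
  by_cases h : n = 0
  · simp only [seqShift, LinearMap.coe_mk, AddHom.coe_mk, h, if_true]
    exact continuous_const
  · simp only [seqShift, LinearMap.coe_mk, AddHom.coe_mk, h, if_false]
    exact continuous_apply _

theorem continuous_seqBackShift : Continuous seqBackShift :=
  continuous_pi fun n => continuous_apply (n + 1)

/-- A realization of the Banach space `E` as a space of complex sequences on the non-negative
integers (through the injective linear map `toSeq`) which contains all finitely supported
sequences and satisfies the three standing hypotheses: density of the finitely supported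
sequences, continuity of the coordinates, and invariance, with a uniform bound, under the maps
`γ_z : (x n) ↦ (z ^ n * x n)` for `z` on the unit circle. -/
structure SequenceSpace (E : Type*) [NormedAddCommGroup E] [NormedSpace ℂ E]
    [CompleteSpace E] where
  /-- The sequence `(x(n))` of an element `x` of the space. -/
  toSeq : E →ₗ[ℂ] (ℕ → ℂ)
  toSeq_injective : Function.Injective toSeq
  finite_mem : ∀ u : ℕ → ℂ, (Function.support u).Finite → ∃ x : E, toSeq x = u
  dense_finite : Dense {x : E | (Function.support (toSeq x)).Finite}
  continuous_coord : ∀ n : ℕ, Continuous fun x : E => toSeq x n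
  rotation_mem : ∃ C : ℝ, ∀ z : ℂ, ‖z‖ = 1 → ∀ x : E, ∃ y : E,
    (∀ n : ℕ, toSeq y n = z ^ n * toSeq x n) ∧ ‖y‖ ≤ C * ‖x‖

namespace SequenceSpace

variable {E : Type*} [NormedAddCommGroup E] [NormedSpace ℂ E] [CompleteSpace E]

/-- The inclusion `A(E) ⊆ E`, for a linear map `A` on all sequences. -/
def Invariant (V : SequenceSpace E) (A : (ℕ → ℂ) →ₗ[ℂ] (ℕ → ℂ)) : Prop :=
  ∀ x : E, ∃ y : E, V.toSeq y = A (V.toSeq x)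

/-- The restriction of `A` to `E`, as a linear map. -/
noncomputable def restrictₗ (V : SequenceSpace E) (A : (ℕ → ℂ) →ₗ[ℂ] (ℕ → ℂ))
    (h : V.Invariant A) : E →ₗ[ℂ] E where
  toFun x := (h x).choose
  map_add' x y := V.toSeq_injective <| by
    rw [(h (x + y)).choose_spec, map_add, map_add, map_add, (h x).choose_spec,
      (h y).choose_spec]
  map_smul' c x := V.toSeq_injective <| by
    rw [(h (c • x)).choose_spec, map_smul, map_smul, RingHom.id_apply, map_smul,
      (h x).choose_spec]

theorem toSeq_restrictₗ (V : SequenceSpace E) (A : (ℕ → ℂ) →ₗ[ℂ] (ℕ → ℂ))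
    (h : V.Invariant A) (x : E) : V.toSeq (V.restrictₗ A h x) = A (V.toSeq x) :=
  (h x).choose_spec

theorem continuous_toSeq (V : SequenceSpace E) : Continuous V.toSeq :=
  continuous_pi V.continuous_coord

/-- The restriction of `A` to `E`, as a bounded operator (closed graph theorem). -/
noncomputable def restrict (V : SequenceSpace E) (A : (ℕ → ℂ) →ₗ[ℂ] (ℕ → ℂ))
    (hA : Continuous A) (h : V.Invariant A) : E →L[ℂ] E :=
  ContinuousLinearMap.ofSeqClosedGraph (g := V.restrictₗ A h) <| by
    intro u x y hu hy
    apply V.toSeq_injective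
    rw [V.toSeq_restrictₗ]
    have h1 := (V.continuous_toSeq.tendsto y).comp hy
    have h2 := ((hA.comp V.continuous_toSeq).tendsto x).comp hu
    refine tendsto_nhds_unique h1 (h2.congr fun n => ?_)
    exact (V.toSeq_restrictₗ A h (u n)).symm

/-- The forward shift `S` as an operator on `E`, when `S(E) ⊆ E`. -/
noncomputable def shift (V : SequenceSpace E) (h : V.Invariant seqShift) : E →L[ℂ] E :=
  V.restrict seqShift continuous_seqShift h

/-- The backward shift `S₋₁` as an operator on `E`, when `S₋₁(E) ⊆ E`. -/
noncomputable def backShift (V : SequenceSpace E) (h : V.Invariant seqBackShift) : E →L[ℂ] E :=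
  V.restrict seqBackShift continuous_seqBackShift h

theorem toSeq_shift (V : SequenceSpace E) (h : V.Invariant seqShift) (x : E) :
    V.toSeq (V.shift h x) = seqShift (V.toSeq x) :=
  V.toSeq_restrictₗ seqShift h x

theorem toSeq_backShift (V : SequenceSpace E) (h : V.Invariant seqBackShift) (x : E) :
    V.toSeq (V.backShift h x) = seqBackShift (V.toSeq x) :=
  V.toSeq_restrictₗ seqBackShift h x

theorem exists_unit (V : SequenceSpace E) (k : ℕ) :
    ∃ x : E, V.toSeq x = Pi.single k (1 : ℂ) :=
  V.finite_mem _ ((Set.finite_singleton k).subset Pi.support_single_subset)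

/-- The element `e_k` of `E`, whose sequence is `1` at `k` and `0` elsewhere. -/
noncomputable def unit (V : SequenceSpace E) (k : ℕ) : E := (V.exists_unit k).choose

theorem toSeq_unit (V : SequenceSpace E) (k : ℕ) :
    V.toSeq (V.unit k) = Pi.single k (1 : ℂ) :=
  (V.exists_unit k).choose_spec

/-- The two-sided coefficient sequence of `T`: it is `(T e_0)(n)` at `n ≥ 0` and
`(T e_n)(0)` at `-n ≤ 0` (the two agree at `0`). -/
noncomputable def coeff (V : SequenceSpace E) (T : E →L[ℂ] E) (n : ℤ) : ℂ :=
  if 0 ≤ n then V.toSeq (T (V.unit 0)) n.toNat else V.toSeq (T (V.unit (-n).toNat)) 0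

/-- The symbol of `T`, the sum of the two-sided series with the coefficients `coeff T n`. Its
convergence is part of what the theorem asserts. -/
noncomputable def symbol (V : SequenceSpace E) (T : E →L[ℂ] E) (z : ℂ) : ℂ :=
  ∑' n : ℤ, V.coeff T n * z ^ n

/-- If `T` commutes with `S`, all coefficients of negative index vanish, so that the terms of
negative index of the series play no role, also at `z = 0`. -/
theorem coeff_eq_zero_of_neg (V : SequenceSpace E) (h : V.Invariant seqShift) (T : E →L[ℂ] E)
    (hT : Commute T (V.shift h)) (n : ℤ) (hn : n < 0) : V.coeff T n = 0 := by
  obtain ⟨k, hk⟩ : ∃ k : ℕ, (-n).toNat = k + 1 := ⟨(-n).toNat - 1, by omega⟩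
  have h1 : V.unit (k + 1) = V.shift h (V.unit k) := V.toSeq_injective <| by
    rw [toSeq_shift, toSeq_unit, toSeq_unit]
    funext m
    cases m with
    | zero => simp [seqShift]
    | succ m => simp [seqShift, Pi.single_apply]
  have h2 : T (V.shift h (V.unit k)) = V.shift h (T (V.unit k)) :=
    congrArg (fun A : E →L[ℂ] E => A (V.unit k)) hT.eq
  rw [coeff, if_neg (not_le.mpr hn), hk, h1, h2, toSeq_shift]
  simp [seqShift]

end SequenceSpace

/-! An operator `T` commuting with `S` has a lower triangular Toeplitz matrix with entries `c n`,
and conjugation by rotations multiplies its `n`-th diagonal by `exp (i n θ)`. So `c n • S ^ n` is a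
Fourier coefficient of `θ ↦ γ θ * T * γ (-θ)`, and `‖c n‖ * ‖S ^ n‖` is bounded in `n`
(`exists_norm_diagonal_le`). An interior point `z` of the spectrum lies strictly closer to the
origin than some spectral point `w`, and `‖w‖ ^ n` is at most a constant times `‖S ^ n‖`; hence `∑ c
n * z ^ n` converges geometrically. Coefficients of products are convolutions, so evaluating the
symbol at `z` is a character of the commutant of `S`. The commutant is closed under inverses, so a
character value of `T` lies in its spectrum (`tsum_mem_spectrum_of_convolution`). The spectrum is
closed, which gives the closure. The backward shift is treated alike, with upper triangular
matrices. -/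

/-! ### Two facts about the complex plane. -/

theorem exists_norm_lt_of_mem_interior {s : Set ℂ} {z : ℂ} (hz : z ∈ interior s) :
    ∃ w ∈ s, ‖z‖ < ‖w‖ := by
  obtain ⟨ε, hε, h⟩ := Metric.mem_nhds_iff.mp (mem_interior_iff_mem_nhds.mp hz)
  -- The point is pushed outwards along its own ray; since `arg 0 = 0`, the direction is `1` when `z
  -- = 0`.
  set u : ℂ := Complex.exp (z.arg * Complex.I) with hu
  have hu1 : ‖u‖ = 1 := Complex.norm_exp_ofReal_mul_I _
  have hzu : z = ‖z‖ * u := (Complex.norm_mul_exp_arg_mul_I z).symm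
  refine ⟨z + (ε / 2 : ℝ) * u, h ?_, ?_⟩
  · rw [Metric.mem_ball, dist_eq_norm, add_sub_cancel_left, norm_mul, hu1, Complex.norm_real,
      Real.norm_of_nonneg (by positivity)]
    linarith
  · have : z + (ε / 2 : ℝ) * u = ((‖z‖ + ε / 2 : ℝ) : ℂ) * u := by
      conv_lhs => rw [hzu]
      push_cast
      ring
    rw [this, norm_mul, hu1, Complex.norm_real, Real.norm_of_nonneg (by positivity)]
    linarith

theorem integral_exp_int_mul (n : ℤ) :
    ∫ θ in (0 : ℝ)..2 * Real.pi, Complex.exp (θ * Complex.I) ^ n =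
      if n = 0 then 2 * (Real.pi : ℂ) else 0 := by
  split_ifs with h
  · simp [h]
  · have hn : (n : ℂ) * Complex.I ≠ 0 := by simp [h]
    have : ∀ θ : ℝ, Complex.exp (θ * Complex.I) ^ n = Complex.exp ((n * Complex.I) * θ) := by
      intro θ
      rw [← Complex.exp_int_mul]
      ring_nf
    simp_rw [this]
    rw [integral_exp_mul_complex hn]
    have : (n : ℂ) * Complex.I * ((2 * Real.pi : ℝ) : ℂ) = n * (2 * Real.pi * Complex.I) := by
      push_cast
      ring
    rw [this, Complex.exp_int_mul_two_pi_mul_I]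
    simp

/-! ### Power series at interior points of a spectrum. -/

section BanachAlgebra

variable {A : Type*} [NormedRing A] [NormedAlgebra ℂ A] [CompleteSpace A]

/-- For `w` in the spectrum with `‖z‖ < ‖w‖`, the power `w ^ n` lies in the spectrum of `a ^ n`; the
series is dominated by a geometric one of ratio `‖z‖ / ‖w‖`. The factor `‖1‖` appears because the
norm of the unit is not assumed to be `1`. -/
theorem summable_norm_mul_pow_of_mem_interior_spectrum {a : A} {c : ℕ → ℂ} {M : ℝ}
    (hc : ∀ n, ‖c n‖ * ‖a ^ n‖ ≤ M) {z : ℂ} (hz : z ∈ interior (spectrum ℂ a)) :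
    Summable fun n => ‖c n * z ^ n‖ := by
  obtain ⟨w, hw, hzw⟩ := exists_norm_lt_of_mem_interior hz
  have hw0 : 0 < ‖w‖ := (norm_nonneg z).trans_lt hzw
  have hr : ‖z‖ / ‖w‖ < 1 := (div_lt_one hw0).mpr hzw
  refine Summable.of_nonneg_of_le (fun _ => norm_nonneg _) (fun n => ?_)
    ((summable_geometric_of_lt_one (by positivity) hr).mul_left (M * ‖(1 : A)‖))
  have h1 : ‖w‖ ^ n ≤ ‖a ^ n‖ * ‖(1 : A)‖ := by
    rw [← norm_pow]
    exact spectrum.norm_le_norm_mul_of_mem (spectrum.pow_mem_pow a n hw)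
  rw [div_pow, mul_div_assoc', le_div_iff₀ (by positivity), norm_mul, norm_pow]
  calc ‖c n‖ * ‖z‖ ^ n * ‖w‖ ^ n ≤ ‖c n‖ * ‖z‖ ^ n * (‖a ^ n‖ * ‖(1 : A)‖) := by gcongr
    _ = (‖c n‖ * ‖a ^ n‖) * ‖(1 : A)‖ * ‖z‖ ^ n := by ring
    _ ≤ M * ‖(1 : A)‖ * ‖z‖ ^ n := by gcongr; exact hc n

/-- If elements commuting with `a` have coefficients which multiply by convolution and are bounded
against the powers of `a`, then the sum of the associated power series at a point of the interior
of the spectrum of `a` belongs to the spectrum. -/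
theorem tsum_mem_spectrum_of_convolution {a : A} (c : A →ₗ[ℂ] ℕ → ℂ)
    (hone : c 1 = Pi.single 0 1)
    (hmul : ∀ u t : A, Commute u a → Commute t a →
      ∀ n, c (u * t) n = ∑ p ∈ Finset.HasAntidiagonal.antidiagonal n, c u p.1 * c t p.2)
    (hbound : ∀ t : A, Commute t a → ∃ M : ℝ, ∀ n, ‖c t n‖ * ‖a ^ n‖ ≤ M)
    {t : A} (ht : Commute t a) {z : ℂ} (hz : z ∈ interior (spectrum ℂ a)) :
    ∑' n, c t n * z ^ n ∈ spectrum ℂ t := by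
  have hsum : ∀ u : A, Commute u a → Summable fun n => ‖c u n * z ^ n‖ := fun u hu =>
    let ⟨_, hM⟩ := hbound u hu
    summable_norm_mul_pow_of_mem_interior_spectrum hM hz
  have hone_sum : HasSum (fun n => c 1 n * z ^ n) 1 := by
    have h := hasSum_single (f := fun n => c 1 n * z ^ n) 0 fun n hn => by simp [hone, hn]
    simpa [hone] using h
  set μ := ∑' n, c t n * z ^ n with hμ
  rw [spectrum.mem_iff]
  intro hunit
  obtain ⟨r, hr⟩ := hunit
  have hcr : Commute (r : A) a := by
    rw [hr]
    exact Commute.sub_left (Algebra.commutes μ a) ht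
  have hcu : Commute (↑r⁻¹ : A) a := hcr.units_inv_left
  have hzero : ∑' n, c (r : A) n * z ^ n = 0 := by
    have h : HasSum (fun n => c (r : A) n * z ^ n) (μ * 1 - μ) := by
      refine ((hone_sum.mul_left μ).sub (hsum t ht).of_norm.hasSum).congr_fun fun n => ?_
      rw [hr, Algebra.algebraMap_eq_smul_one, map_sub, map_smul]
      simp only [Pi.sub_apply, Pi.smul_apply, smul_eq_mul]
      ring
    rw [h.tsum_eq]
    ring
  -- The Cauchy product of the series of `r⁻¹` and `r` is the series of `1`, with sum `1`, although
  -- the series of `r = μ - t` sums to `0`.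
  have hprod := tsum_mul_tsum_eq_tsum_sum_antidiagonal_of_summable_norm
    (hsum _ hcu) (hsum _ hcr)
  have : ∀ n, ∑ p ∈ Finset.HasAntidiagonal.antidiagonal n,
      c (↑r⁻¹ : A) p.1 * z ^ p.1 * (c (r : A) p.2 * z ^ p.2) = c 1 n * z ^ n := by
    intro n
    rw [← Units.inv_mul r, hmul _ _ hcu hcr, Finset.sum_mul]
    refine Finset.sum_congr rfl fun p hp => ?_
    rw [← Finset.HasAntidiagonal.mem_antidiagonal.mp hp, pow_add]
    ring
  rw [hzero, mul_zero, tsum_congr this, hone_sum.tsum_eq] at hprod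
  exact zero_ne_one hprod

end BanachAlgebra

theorem ContinuousLinearMap.apply_pow_of_commute {E : Type*} [NormedAddCommGroup E]
    [NormedSpace ℂ E] {T A : E →L[ℂ] E} (hT : Commute T A) (n : ℕ) (x : E) :
    T ((A ^ n) x) = (A ^ n) (T x) :=
  congrArg (fun B : E →L[ℂ] E => B x) (hT.pow_right n).eq

/-! ### Rotations and the diagonals of an operator. -/

namespace SequenceSpace

variable {E : Type*} [NormedAddCommGroup E] [NormedSpace ℂ E] [CompleteSpace E]

theorem exists_rotation (V : SequenceSpace E) :
    ∃ (C : ℝ) (γ : ℝ → E →L[ℂ] E), 0 ≤ C ∧ (∀ θ, ‖γ θ‖ ≤ C) ∧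
      ∀ θ x n, V.toSeq (γ θ x) n = Complex.exp (θ * Complex.I) ^ n * V.toSeq x n := by
  obtain ⟨C, hC⟩ := V.rotation_mem
  choose f hf hfC using fun θ : ℝ => hC _ (Complex.norm_exp_ofReal_mul_I θ)
  refine ⟨|C|, fun θ => LinearMap.mkContinuous
    { toFun := f θ
      map_add' := fun x y => V.toSeq_injective <| funext fun n => ?_
      map_smul' := fun a x => V.toSeq_injective <| funext fun n => ?_ } |C| fun x => ?_,
    abs_nonneg C, fun θ => ?_, fun θ x n => hf θ x n⟩
  · simp only [map_add, Pi.add_apply, hf]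
    ring
  · simp only [map_smul, Pi.smul_apply, hf, smul_eq_mul, RingHom.id_apply]
    ring
  · exact (hfC θ x).trans (mul_le_mul_of_nonneg_right (le_abs_self C) (norm_nonneg x))
  · exact LinearMap.mkContinuous_norm_le _ (abs_nonneg C) _

theorem eq_sum_unit (V : SequenceSpace E) {x : E} (hx : (Function.support (V.toSeq x)).Finite) :
    x = ∑ k ∈ hx.toFinset, V.toSeq x k • V.unit k := by
  apply V.toSeq_injective
  funext m
  simp only [map_sum, map_smul, toSeq_unit, Finset.sum_apply, Pi.smul_apply, smul_eq_mul,
    Pi.single_apply, mul_ite, mul_one, mul_zero, Finset.sum_ite_eq]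
  simp

/-- On a finitely supported element the orbit is a trigonometric polynomial; the uniform bound `C`
carries continuity over to limits. -/
theorem continuous_rotation (V : SequenceSpace E) {C : ℝ} {γ : ℝ → E →L[ℂ] E}
    (hC : ∀ θ, ‖γ θ‖ ≤ C)
    (hγ : ∀ θ x n, V.toSeq (γ θ x) n = Complex.exp (θ * Complex.I) ^ n * V.toSeq x n) (x : E) :
    Continuous fun θ => γ θ x := by
  have hC0 : 0 ≤ C := (norm_nonneg _).trans (hC 0)
  refine continuous_of_uniform_approx_of_continuous fun u hu => ?_
  obtain ⟨ε, hε, hεu⟩ := Metric.mem_uniformity_dist.mp hu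
  obtain ⟨y, hy, hxy⟩ := Metric.dense_iff.mp V.dense_finite x (ε / (C + 1)) (by positivity)
  refine ⟨fun θ => γ θ y, ?_, fun θ => ?_⟩
  · have hunit : ∀ θ k, γ θ (V.unit k) = Complex.exp (θ * Complex.I) ^ k • V.unit k := by
      intro θ k
      apply V.toSeq_injective
      funext m
      rw [hγ, map_smul, Pi.smul_apply, toSeq_unit, smul_eq_mul]
      by_cases h : m = k <;> simp [h]
    rw [V.eq_sum_unit hxy]
    simp only [map_sum, map_smul, hunit]
    fun_prop
  · refine hεu ?_
    rw [dist_eq_norm, ← map_sub]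
    rw [Metric.mem_ball, dist_comm, dist_eq_norm, lt_div_iff₀ (by positivity)] at hy
    have := (γ θ).le_of_opNorm_le (hC θ) (x - y)
    nlinarith [norm_nonneg (x - y)]

/-- The part of `T` which shifts the degree by `d` is bounded, uniformly in `d`. -/
theorem exists_norm_diagonal_le (V : SequenceSpace E) (T : E →L[ℂ] E) :
    ∃ M : ℝ, 0 ≤ M ∧ ∀ (d : ℤ) (x y : E) (hx : (Function.support (V.toSeq x)).Finite),
      (∀ m : ℕ, V.toSeq y m = ∑ k ∈ hx.toFinset,
        if (m : ℤ) = k + d then V.toSeq x k * V.toSeq (T (V.unit k)) m else 0) →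
      ‖y‖ ≤ M * ‖x‖ := by
  obtain ⟨C, γ, hC0, hC, hγ⟩ := V.exists_rotation
  refine ⟨C * ‖T‖ * C, by positivity, fun d x y hx hy => ?_⟩
  set e : ℝ → ℂ := fun θ => Complex.exp (θ * Complex.I) with he
  have he0 : ∀ θ, e θ ≠ 0 := fun θ => Complex.exp_ne_zero _
  have he1 : ∀ θ, ‖e θ‖ = 1 := fun θ => Complex.norm_exp_ofReal_mul_I _
  have hec : Continuous e := by fun_prop
  have hen : ∀ θ, e (-θ) = (e θ)⁻¹ := by
    intro θ
    simp only [he]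
    rw [← Complex.exp_neg]
    push_cast
    ring_nf
  -- The mean of `f` over a period is the degree-`d` part `y` of `T x`.
  set f : ℝ → E := fun θ => e θ ^ (-d) • γ θ (T (γ (-θ) x)) with hf
  have hf_sum : ∀ θ, f θ = ∑ k ∈ hx.toFinset,
      (e θ ^ (-d) * e θ ^ (-(k : ℤ)) * V.toSeq x k) • γ θ (T (V.unit k)) := by
    intro θ
    have h1 : γ (-θ) x = ∑ k ∈ hx.toFinset, (e θ ^ (-(k : ℤ)) * V.toSeq x k) • V.unit k := by
      apply V.toSeq_injective
      funext m
      rw [hγ]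
      conv_rhs => simp only [map_sum, map_smul, toSeq_unit, Finset.sum_apply, Pi.smul_apply,
        smul_eq_mul, Pi.single_apply, mul_ite, mul_one, mul_zero, Finset.sum_ite_eq]
      change e (-θ) ^ m * _ = _
      rw [hen]
      by_cases hm : V.toSeq x m = 0
      · simp [hm]
      · simp [hm]
    simp only [hf, h1, map_sum, map_smul, Finset.smul_sum, smul_smul, mul_assoc]
  -- Rotations are only strongly continuous; the finite sum leaves a single rotation applied to
  -- fixed vectors.
  have hfc : Continuous f := by
    rw [funext hf_sum]
    refine continuous_finsetSum _ fun k _ => Continuous.smul ?_ (V.continuous_rotation hC hγ _)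
    exact ((hec.zpow₀ _ fun θ => Or.inl (he0 θ)).mul
      (hec.zpow₀ _ fun θ => Or.inl (he0 θ))).mul continuous_const
  have hint : ∫ θ in (0 : ℝ)..2 * Real.pi, f θ = (2 * (Real.pi : ℂ)) • y := by
    apply V.toSeq_injective
    funext m
    let φ : E →L[ℂ] ℂ := ⟨(LinearMap.proj m).comp V.toSeq, V.continuous_coord m⟩
    have hφ : ∀ v, V.toSeq v m = φ v := fun _ => rfl
    rw [hφ, ← ContinuousLinearMap.intervalIntegral_comp_comm φ (hfc.intervalIntegrable _ _)]
    rw [map_smul, Pi.smul_apply, hy, smul_eq_mul, Finset.mul_sum]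
    -- The matrix entry `(m, k)` carries the frequency `m - k - d`, so integration keeps only `m = k
    -- + d`.
    have h2 : ∀ θ, φ (f θ) = ∑ k ∈ hx.toFinset,
        e θ ^ ((m : ℤ) - k - d) * (V.toSeq x k * V.toSeq (T (V.unit k)) m) := by
      intro θ
      rw [hf_sum, map_sum]
      refine Finset.sum_congr rfl fun k _ => ?_
      rw [map_smul, smul_eq_mul, ← hφ, hγ]
      change _ * (e θ ^ m * _) = _
      rw [show (m : ℤ) - k - d = -d + -(k : ℤ) + m by ring, zpow_add₀ (he0 θ),
        zpow_add₀ (he0 θ), zpow_natCast]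
      ring
    simp_rw [h2]
    rw [intervalIntegral.integral_finsetSum]
    · refine Finset.sum_congr rfl fun k _ => ?_
      rw [intervalIntegral.integral_mul_const, integral_exp_int_mul]
      by_cases h : (m : ℤ) = k + d
      · rw [if_pos h, if_pos (by omega)]
      · rw [if_neg h, if_neg (by omega)]
        simp
    · intro k _
      exact ((hec.zpow₀ _ fun θ => Or.inl (he0 θ)).mul
        continuous_const).intervalIntegrable _ _
  have hbound : ∀ θ, ‖f θ‖ ≤ C * ‖T‖ * C * ‖x‖ := by
    intro θ
    simp only [hf]
    rw [norm_smul, norm_zpow, he1, one_zpow, one_mul]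
    calc ‖γ θ (T (γ (-θ) x))‖ ≤ C * ‖T (γ (-θ) x)‖ := (γ θ).le_of_opNorm_le (hC θ) _
      _ ≤ C * (‖T‖ * (C * ‖x‖)) := by
        gcongr
        exact T.le_opNorm_of_le ((γ (-θ)).le_of_opNorm_le (hC _) _)
      _ = C * ‖T‖ * C * ‖x‖ := by ring
  have h3 := intervalIntegral.norm_integral_le_of_norm_le_const (a := 0) (b := 2 * Real.pi)
    fun θ _ => hbound θ
  have hpi : 0 < 2 * Real.pi := by positivity
  rw [hint, norm_smul, sub_zero, abs_of_pos hpi, mul_comm] at h3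
  have h4 : ‖(2 * (Real.pi : ℂ))‖ = 2 * Real.pi := by
    rw [norm_mul, Complex.norm_real, Real.norm_of_nonneg Real.pi_pos.le]
    simp
  rw [h4] at h3
  exact le_of_mul_le_mul_right h3 hpi

/-- A bound for `‖c n‖ * ‖A ^ n‖`, where `c n • A ^ n` is the part of `T` which shifts the degree
by `d n`. -/
theorem exists_norm_coeff_mul_norm_pow_le (V : SequenceSpace E) (T A : E →L[ℂ] E) (c : ℕ → ℂ)
    (d : ℕ → ℤ)
    (hc : ∀ n k m : ℕ, c n * V.toSeq ((A ^ n) (V.unit k)) m =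
      if (m : ℤ) = k + d n then V.toSeq (T (V.unit k)) m else 0) :
    ∃ M : ℝ, ∀ n, ‖c n‖ * ‖A ^ n‖ ≤ M := by
  obtain ⟨M, hM0, hM⟩ := V.exists_norm_diagonal_le T
  refine ⟨M, fun n => ?_⟩
  rw [← norm_smul]
  refine ContinuousLinearMap.opNorm_le_bound _ hM0 fun x => ?_
  have hcl : IsClosed {x : E | ‖(c n • A ^ n) x‖ ≤ M * ‖x‖} :=
    isClosed_le (by fun_prop) (by fun_prop)
  refine (hcl.closure_subset_iff.mpr ?_) (V.dense_finite x)
  intro y hy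
  refine hM (d n) y _ hy fun m => ?_
  conv_lhs => rw [V.eq_sum_unit hy]
  simp only [map_sum, map_smul, Finset.sum_apply, Pi.smul_apply, smul_eq_mul,
    smul_apply]
  refine Finset.sum_congr rfl fun k _ => ?_
  rw [hc]
  split_ifs <;> simp

/-! ### Toeplitz coefficients of operators commuting with a shift. -/

theorem toSeq_shift_pow (V : SequenceSpace E) (h : V.Invariant seqShift) (n : ℕ) (x : E) (m : ℕ) :
    V.toSeq ((V.shift h ^ n) x) m = if n ≤ m then V.toSeq x (m - n) else 0 := by
  induction n generalizing m with
  | zero => simp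
  | succ n ih =>
    rw [pow_succ', mul_apply_eq_comp, toSeq_shift]
    cases m with
    | zero => simp [seqShift]
    | succ m =>
      have h1 : seqShift (V.toSeq ((V.shift h ^ n) x)) (m + 1) =
          V.toSeq ((V.shift h ^ n) x) m := rfl
      simp only [h1, ih, Nat.add_le_add_iff_right, Nat.add_sub_add_right]

theorem toSeq_backShift_pow (V : SequenceSpace E) (h : V.Invariant seqBackShift) (n : ℕ) (x : E)
    (m : ℕ) : V.toSeq ((V.backShift h ^ n) x) m = V.toSeq x (m + n) := by
  induction n generalizing m with
  | zero => simp
  | succ n ih =>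
    rw [pow_succ', mul_apply_eq_comp, toSeq_backShift]
    exact (ih (m + 1)).trans (congrArg (V.toSeq x) (by omega))

theorem shift_pow_unit_zero (V : SequenceSpace E) (h : V.Invariant seqShift) (n : ℕ) :
    (V.shift h ^ n) (V.unit 0) = V.unit n := by
  apply V.toSeq_injective
  funext m
  rw [toSeq_shift_pow, toSeq_unit, toSeq_unit, Pi.single_apply, Pi.single_apply]
  split_ifs <;> first | rfl | omega

theorem backShift_pow_unit (V : SequenceSpace E) (h : V.Invariant seqBackShift) (n k : ℕ) :
    (V.backShift h ^ n) (V.unit k) = if n ≤ k then V.unit (k - n) else 0 := by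
  apply V.toSeq_injective
  funext m
  rw [toSeq_backShift_pow]
  split_ifs with hnk
  · rw [toSeq_unit, toSeq_unit, Pi.single_apply, Pi.single_apply]
    split_ifs <;> first | rfl | omega
  · rw [toSeq_unit, Pi.single_apply, if_neg (by omega)]
    simp

/-- The coefficients of non-negative index. -/
noncomputable def forwardCoeff (V : SequenceSpace E) : (E →L[ℂ] E) →ₗ[ℂ] ℕ → ℂ where
  toFun T n := V.toSeq (T (V.unit 0)) n
  map_add' T U := by funext n; simp
  map_smul' a T := by funext n; simp

/-- The coefficients of non-positive index. -/
noncomputable def backwardCoeff (V : SequenceSpace E) : (E →L[ℂ] E) →ₗ[ℂ] ℕ → ℂ where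
  toFun T n := V.toSeq (T (V.unit n)) 0
  map_add' T U := by funext n; simp
  map_smul' a T := by funext n; simp

theorem forwardCoeff_one (V : SequenceSpace E) : V.forwardCoeff 1 = Pi.single 0 1 :=
  V.toSeq_unit 0

theorem backwardCoeff_one (V : SequenceSpace E) : V.backwardCoeff 1 = Pi.single 0 1 := by
  funext n
  change V.toSeq (V.unit n) 0 = _
  rw [toSeq_unit, Pi.single_apply, Pi.single_apply]
  simp only [eq_comm]

/-- `T e_k = T S^k e_0 = S^k T e_0`. -/
theorem toSeq_apply_unit_of_commute_shift (V : SequenceSpace E) (hS : V.Invariant seqShift)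
    {T : E →L[ℂ] E} (hT : Commute T (V.shift hS)) (k m : ℕ) :
    V.toSeq (T (V.unit k)) m = if k ≤ m then V.forwardCoeff T (m - k) else 0 := by
  rw [← V.shift_pow_unit_zero hS k, ContinuousLinearMap.apply_pow_of_commute hT, toSeq_shift_pow]
  rfl

/-- Coordinate `m` is coordinate `0` after `m` backward shifts, and these pass through `T` to lower
`e_k`. -/
theorem toSeq_apply_unit_of_commute_backShift (V : SequenceSpace E)
    (hB : V.Invariant seqBackShift) {T : E →L[ℂ] E} (hT : Commute T (V.backShift hB)) (k m : ℕ) :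
    V.toSeq (T (V.unit k)) m = if m ≤ k then V.backwardCoeff T (k - m) else 0 := by
  rw [← zero_add m, ← V.toSeq_backShift_pow hB, zero_add,
    ← ContinuousLinearMap.apply_pow_of_commute hT,
    backShift_pow_unit]
  split_ifs
  · rfl
  · simp

/-- `T e_0` may have infinite support, so `U` is shown to act as a convolution on all of `E`: on
finitely supported elements by the Toeplitz form, then by density, as only finitely many coordinates
enter. -/
theorem forwardCoeff_mul (V : SequenceSpace E) (hS : V.Invariant seqShift)
    {U T : E →L[ℂ] E} (hU : Commute U (V.shift hS)) (n : ℕ) :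
    V.forwardCoeff (U * T) n =
      ∑ p ∈ Finset.HasAntidiagonal.antidiagonal n, V.forwardCoeff U p.1 * V.forwardCoeff T p.2 := by
  suffices h : ∀ x : E, V.toSeq (U x) n =
      ∑ p ∈ Finset.HasAntidiagonal.antidiagonal n, V.forwardCoeff U p.1 * V.toSeq x p.2 from h _
  intro x
  have hcont := fun m => V.continuous_coord m
  have hcl : IsClosed {x : E | V.toSeq (U x) n =
      ∑ p ∈ Finset.HasAntidiagonal.antidiagonal n, V.forwardCoeff U p.1 * V.toSeq x p.2} :=
    isClosed_eq ((hcont n).comp U.continuous)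
      (continuous_finsetSum _ fun p _ => continuous_const.mul (hcont _))
  refine (hcl.closure_subset_iff.mpr fun y hy => ?_) (V.dense_finite x)
  change V.toSeq (U y) n = _
  conv_lhs => rw [V.eq_sum_unit hy]
  simp only [map_sum, map_smul, Finset.sum_apply, Pi.smul_apply, smul_eq_mul,
    V.toSeq_apply_unit_of_commute_shift hS hU]
  rw [← Finset.Nat.sum_antidiagonal_swap, Finset.Nat.sum_antidiagonal_eq_sum_range_succ_mk]
  simp only [mul_ite, mul_zero, Prod.fst_swap, Prod.snd_swap]
  rw [← Finset.sum_filter]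
  refine (Finset.sum_congr rfl fun _ _ => mul_comm _ _).trans
    (Finset.sum_subset (fun k hk => ?_) fun k hk hk' => ?_)
  · rw [Finset.mem_range, Nat.lt_succ_iff]
    exact (Finset.mem_filter.mp hk).2
  · rw [Finset.mem_range, Nat.lt_succ_iff] at hk
    have : V.toSeq y k = 0 := by
      by_contra h
      exact hk' (Finset.mem_filter.mpr ⟨hy.mem_toFinset.mpr h, hk⟩)
    rw [this, mul_zero]

/-- Upper triangularity makes `T e_n` a finite combination of units, so no density argument is
needed. -/
theorem backwardCoeff_mul (V : SequenceSpace E) (hB : V.Invariant seqBackShift)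
    {U T : E →L[ℂ] E} (hT : Commute T (V.backShift hB)) (n : ℕ) :
    V.backwardCoeff (U * T) n =
      ∑ p ∈ Finset.HasAntidiagonal.antidiagonal n, V.backwardCoeff U p.1 * V.backwardCoeff T p.2 := by
  have h : T (V.unit n) =
      ∑ p ∈ Finset.HasAntidiagonal.antidiagonal n, V.backwardCoeff T p.2 • V.unit p.1 := by
    apply V.toSeq_injective
    funext m
    rw [V.toSeq_apply_unit_of_commute_backShift hB hT,
      Finset.Nat.sum_antidiagonal_eq_sum_range_succ_mk]
    simp only [map_sum, map_smul, toSeq_unit, Finset.sum_apply, Pi.smul_apply, smul_eq_mul,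
      Pi.single_apply, mul_ite, mul_one, mul_zero, Finset.sum_ite_eq, Finset.mem_range,
      Nat.lt_succ_iff]
  change V.toSeq (U (T (V.unit n))) 0 = _
  rw [h]
  simp only [map_sum, map_smul, Finset.sum_apply, Pi.smul_apply, smul_eq_mul]
  exact Finset.sum_congr rfl fun p _ => mul_comm _ _

theorem exists_norm_forwardCoeff_le (V : SequenceSpace E) (hS : V.Invariant seqShift)
    {T : E →L[ℂ] E} (hT : Commute T (V.shift hS)) :
    ∃ M : ℝ, ∀ n, ‖V.forwardCoeff T n‖ * ‖V.shift hS ^ n‖ ≤ M := by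
  refine V.exists_norm_coeff_mul_norm_pow_le T _ _ (fun n => n) fun n k m => ?_
  rw [V.toSeq_apply_unit_of_commute_shift hS hT, toSeq_shift_pow, toSeq_unit, Pi.single_apply]
  by_cases h : (m : ℤ) = k + n
  · rw [if_pos h, if_pos (by omega), if_pos (by omega), if_pos (by omega), mul_one,
      show m - k = n by omega]
  · rw [if_neg h]
    split_ifs <;> first | omega | simp

theorem exists_norm_backwardCoeff_le (V : SequenceSpace E) (hB : V.Invariant seqBackShift)
    {T : E →L[ℂ] E} (hT : Commute T (V.backShift hB)) :
    ∃ M : ℝ, ∀ n, ‖V.backwardCoeff T n‖ * ‖V.backShift hB ^ n‖ ≤ M := by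
  refine V.exists_norm_coeff_mul_norm_pow_le T _ _ (fun n => -n) fun n k m => ?_
  rw [V.toSeq_apply_unit_of_commute_backShift hB hT, toSeq_backShift_pow, toSeq_unit,
    Pi.single_apply]
  by_cases h : (m : ℤ) = k + -n
  · rw [if_pos h, if_pos (by omega), if_pos (by omega), mul_one, show k - m = n by omega]
  · rw [if_neg h, if_neg (by omega), mul_zero]

theorem coeff_natCast (V : SequenceSpace E) (T : E →L[ℂ] E) (n : ℕ) :
    V.coeff T n = V.forwardCoeff T n := by
  rw [coeff, if_pos (by omega), Int.toNat_natCast]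
  rfl

theorem coeff_neg_natCast (V : SequenceSpace E) (T : E →L[ℂ] E) (n : ℕ) :
    V.coeff T (-n) = V.backwardCoeff T n := by
  cases n with
  | zero => rfl
  | succ n =>
    rw [coeff, if_neg (by omega), neg_neg, Int.toNat_natCast]
    rfl

theorem coeff_eq_zero_of_pos (V : SequenceSpace E) (hB : V.Invariant seqBackShift)
    {T : E →L[ℂ] E} (hT : Commute T (V.backShift hB)) (n : ℤ) (hn : 0 < n) : V.coeff T n = 0 := by
  lift n to ℕ using hn.le
  rw [coeff_natCast]
  change V.toSeq (T (V.unit 0)) n = 0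
  rw [V.toSeq_apply_unit_of_commute_backShift hB hT, if_neg (by omega)]

end SequenceSpace

/-! ### The two spectral inclusions. -/

theorem theorem5 {E : Type*} [NormedAddCommGroup E] [NormedSpace ℂ E] [CompleteSpace E]
    (V : SequenceSpace E) (hS : V.Invariant seqShift) (hB : V.Invariant seqBackShift)
    (T : E →L[ℂ] E) :
    (Commute T (V.shift hS) →
      (∀ z ∈ interior (spectrum ℂ (V.shift hS)),
        Summable fun n : ℤ => V.coeff T n * z ^ n) ∧
      closure (V.symbol T '' interior (spectrum ℂ (V.shift hS))) ⊆ spectrum ℂ T) ∧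
    (Commute T (V.backShift hB) →
      (∀ z ∈ interior (spectrum ℂ (V.backShift hB)) \ {0},
        Summable fun n : ℤ => V.coeff T n * z⁻¹ ^ n) ∧
      closure ((fun z : ℂ => V.symbol T z⁻¹) ''
        (interior (spectrum ℂ (V.backShift hB)) \ {0})) ⊆ spectrum ℂ T) := by
  refine ⟨fun hT => ?_, fun hT => ?_⟩
  · have key : ∀ z ∈ interior (spectrum ℂ (V.shift hS)),
        HasSum (fun n : ℤ => V.coeff T n * z ^ n) (∑' n : ℕ, V.forwardCoeff T n * z ^ n) := by
      intro z hz
      obtain ⟨M, hM⟩ := V.exists_norm_forwardCoeff_le hS hT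
      have h := (summable_norm_mul_pow_of_mem_interior_spectrum hM hz).of_norm.hasSum
      refine ((Nat.cast_injective (R := ℤ)).hasSum_iff fun n hn => ?_).mp
        (h.congr_fun fun n => ?_)
      · have hneg : n < 0 := by
          by_contra! h0
          exact hn ⟨n.toNat, Int.toNat_of_nonneg h0⟩
        rw [V.coeff_eq_zero_of_neg hS T hT n hneg, zero_mul]
      · simp [V.coeff_natCast]
    refine ⟨fun z hz => (key z hz).summable, ?_⟩
    refine (spectrum.isClosed T).closure_subset_iff.mpr ?_
    rintro _ ⟨z, hz, rfl⟩
    rw [SequenceSpace.symbol, (key z hz).tsum_eq]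
    exact tsum_mem_spectrum_of_convolution V.forwardCoeff V.forwardCoeff_one
      (fun U W hU _ => V.forwardCoeff_mul hS hU)
      (fun U hU => V.exists_norm_forwardCoeff_le hS hU) hT hz
  -- The reindexing `n ↦ -n` turns powers of `z⁻¹` into powers of `z`. With `0⁻¹ = 0`, the identity
  -- holds at `z = 0` too, where only index `0` contributes.
  · have key : ∀ z ∈ interior (spectrum ℂ (V.backShift hB)),
        HasSum (fun n : ℤ => V.coeff T n * z⁻¹ ^ n) (∑' n : ℕ, V.backwardCoeff T n * z ^ n) := by
      intro z hz
      obtain ⟨M, hM⟩ := V.exists_norm_backwardCoeff_le hB hT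
      have h := (summable_norm_mul_pow_of_mem_interior_spectrum hM hz).of_norm.hasSum
      refine ((neg_injective.comp (Nat.cast_injective (R := ℤ))).hasSum_iff fun n hn => ?_).mp
        (h.congr_fun fun n => ?_)
      · have hpos : 0 < n := by
          by_contra! h0
          exact hn ⟨(-n).toNat, by simp [Int.toNat_of_nonneg (neg_nonneg.mpr h0)]⟩
        rw [V.coeff_eq_zero_of_pos hB hT n hpos, zero_mul]
      · simp [V.coeff_neg_natCast]
    refine ⟨fun z hz => (key z hz.1).summable, ?_⟩
    refine (spectrum.isClosed T).closure_subset_iff.mpr ?_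
    rintro _ ⟨z, hz, rfl⟩
    simp only [SequenceSpace.symbol]
    rw [(key z hz.1).tsum_eq]
    exact tsum_mem_spectrum_of_convolution V.backwardCoeff V.backwardCoeff_one
      (fun U W _ hW => V.backwardCoeff_mul hB hW)
      (fun U hU => V.exists_norm_backwardCoeff_le hB hU) hT hz.1
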